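/- Let $\mathbb H=\mathbb C\times\mathbb R$ be the Heisenberg group with product $(z,t)\cdot(z',t')=(z+z',\,t+t'+\tfrac12\operatorname{Im}(\bar z z'))$, norm $\|(z,t)\|=\max\{|z|,|t|^{1/2}\}$ and left-invariant metric $d(p,q)=\|q^{-1}\cdot p\|$. Closed balls $B(x,r)$, distances, diameters and the Hausdorff measure $\mathcal H^3$ refer to $d$. *Vertical subgroups and projections.* A vertical subgroup is a set $\mathbb W=V\times\mathbb R$ with $V\subset\mathbb C$ a line through $0$; put $\mathbb V=V^\perp\times\{0\}$. Every $p\in\mathbb H$ is uniquely $p=p_{\mathbb W}\cdot p_{\mathbb V}$ with $p_{\mathbb W}\in\mathbb W$, $p_{\mathbb V}\in\mathbb V$, and $\pi_{\mathbb W}(p)=p_{\mathbb W}$ is the vertical projection. $\mathcal L^2$ is Lebesgue (outer) measure on $\mathbb W\cong\mathbb R^2$. A set $\Gamma\subset\mathbb H$ is an intrinsic $L$-Lipschitz graph over $\mathbb W$ if $(x\cdot C_{\mathbb W}(a))\cap\Gamma=\{x\}$ for all $x\in\Gamma$ and $0<a<1/L$, where $C_{\mathbb W}(a)=\{p:\|p_{\mathbb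 W}\|\le a\|p_{\mathbb V}\|\}$. *Regularity and the WGL.* A closed set $E\subset\mathbb H$ is $3$-regular with constant $C\ge1$ if $C^{-1}r^3\le\mathcal H^3(B(x,r)\cap E)\le Cr^3$ for all $x\in E$ and $0<r\le\operatorname{diam}E$ (with $r<\infty$). Put $$\beta_E(B(x,r))=\inf_{\mathbb W,\,z}\ \sup_{y\in B(x,r)\cap E}\frac{\operatorname{dist}(y,z\cdot\mathbb W)}{r},$$ the infimum being over all vertical subgroups $\mathbb W$ and all $z\in\mathbb H$. For $\gamma:\mathbb R\to[0,\infty)$, the set $E$ satisfies the weak geometric lemma (WGL) with constants $\gamma$ if $$\int_0^R\mathcal H^3\big(\{y\in E\cap B(x,R):\beta_E(B(y,s))>\varepsilon\}\big)\,\frac{ds}{s}\le\gamma(\varepsilon)R^3\qquad\text{for all }\varepsilon>0,\ x\in E,\ R>0.$$ *David cubes.* A system of David cubes on $E$ with constant $c>0$ is a family of partitions $\Delta_j$ of $E$ into non-empty sets, $j\in\mathbb Z$, such that: if $j\le k$, $Q\in\Delta_j$, $Q'\in\Delta_k$, then $Q\cap Q'=\emptyset$ or $Q\subset Q'$; every $Q\in\Delta_j$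 has $\operatorname{diam}Q\le2^j$; and every $Q\in\Delta_j$ contains $B(z_Q,c2^j)\cap E$ for some $z_Q\in Q$. **Theorem.** Let $C\ge 1$, $\gamma:\mathbb R\to[0,\infty)$, $c>0$ and $b>0$. There are $\alpha>0$ and $M\in\mathbb N$, depending only on $b$, $C$, $\gamma$ and $c$, with the following property. Let $E\subset\mathbb H$ be $3$-regular with constant $C$ and satisfy the WGL with constants $\gamma$, and let $(\Delta_j)_{j\in\mathbb Z}$ be a system of David cubes on $E$ with constant $c$. Then for every cube $Q_0\in\bigcup_j\Delta_j$ and every vertical subgroup $\mathbb W$ there are sets $F_1,\dots,F_M\subset Q_0$ (possibly empty), each an intrinsic $(1/\alpha)$-Lipschitz graph over $\mathbb W$, such that $$\mathcal L^2\Big(\pi_{\mathbb W}\Big(Q_0\setminus\bigcup_{j=1}^MF_j\Big)\Big)\le b\,\mathcal H^3(Q_0).$$ -/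

import Mathlib

open Set MeasureTheory
open scoped ENNReal NNReal ComplexConjugate

noncomputable section

/-- The first Heisenberg group, as the set `ℂ × ℝ` of points `(z, t)` with `z = x + iy`. -/
@[ext]
structure Heis where
  z : ℂ
  t : ℝ

namespace Heis

/-- `ω(z, z') = (x y' - y x') / 4`. -/
def omega (z w : ℂ) : ℝ := (conj z * w).im / 4

theorem omega_eq (z w : ℂ) : omega z w = (z.re * w.im - z.im * w.re) / 4 := by
  simp [omega]; ring

instance : Mul Heis := ⟨fun p q => ⟨p.z + q.z, p.t + q.t + 2 * omega p.z q.z⟩⟩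
instance : One Heis := ⟨⟨0, 0⟩⟩
instance : Inv Heis := ⟨fun p => ⟨-p.z, -p.t⟩⟩

@[simp] theorem mul_z (p q : Heis) : (p * q).z = p.z + q.z := rfl
@[simp] theorem mul_t (p q : Heis) : (p * q).t = p.t + q.t + 2 * omega p.z q.z := rfl
@[simp] theorem one_z : (1 : Heis).z = 0 := rfl
@[simp] theorem one_t : (1 : Heis).t = 0 := rfl
@[simp] theorem inv_z (p : Heis) : (p⁻¹).z = -p.z := rfl
@[simp] theorem inv_t (p : Heis) : (p⁻¹).t = -p.t := rfl

/-- The group law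
`(x, y, t) * (x', y', t') = (x + x', y + y', t + t' + (x y' - y x') / 2)`. -/
instance : Group Heis :=
  Group.ofLeftAxioms
    (by intro p q r
        ext1
        · simp [add_assoc]
        · simp [omega_eq]; ring)
    (by intro p
        ext1 <;> simp [omega_eq])
    (by intro p
        ext1
        · simp
        · simp [omega_eq]; ring)

/-- The homogeneous norm `max {|z|, |t|^{1/2}}`. -/
def hnorm (p : Heis) : ℝ := max ‖p.z‖ (Real.sqrt |p.t|)

theorem norm_z_le (p : Heis) : ‖p.z‖ ≤ hnorm p := le_max_left _ _

theorem hnorm_nonneg (p : Heis) : 0 ≤ hnorm p := (norm_nonneg _).trans (norm_z_le p)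

theorem abs_t_le (p : Heis) : |p.t| ≤ hnorm p ^ 2 :=
  (Real.sqrt_le_left (hnorm_nonneg p)).1 (le_max_right _ _)

theorem hnorm_inv (p : Heis) : hnorm p⁻¹ = hnorm p := by simp [hnorm]

theorem abs_omega_le (z w : ℂ) : |omega z w| ≤ ‖z‖ * ‖w‖ / 4 := by
  have h : |(conj z * w).im| ≤ ‖z‖ * ‖w‖ := by
    simpa using Complex.abs_im_le_norm (conj z * w)
  rw [omega, abs_div, abs_of_pos (by norm_num : (0 : ℝ) < 4)]
  linarith

theorem hnorm_mul_le (p q : Heis) : hnorm (p * q) ≤ hnorm p + hnorm q := by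
  have hp := hnorm_nonneg p
  have hq := hnorm_nonneg q
  refine max_le ((norm_add_le _ _).trans (add_le_add (norm_z_le p) (norm_z_le q))) ?_
  refine (Real.sqrt_le_left (add_nonneg hp hq)).2 ?_
  have h1 := abs_omega_le p.z q.z
  have h2 : ‖p.z‖ * ‖q.z‖ ≤ hnorm p * hnorm q :=
    mul_le_mul (norm_z_le p) (norm_z_le q) (norm_nonneg _) hp
  have h3 : |(p * q).t| ≤ |p.t| + |q.t| + 2 * |omega p.z q.z| := by
    rw [mul_t]
    refine (abs_add_le _ _).trans (add_le_add (abs_add_le _ _) ?_)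
    rw [abs_mul]; norm_num
  nlinarith [abs_t_le p, abs_t_le q, mul_nonneg hp hq]

/-- The left-invariant metric `d(p, q) = ‖q⁻¹ * p‖`. -/
instance : MetricSpace Heis where
  dist p q := hnorm (q⁻¹ * p)
  dist_self p := by simp [hnorm]
  dist_comm p q := by
    rw [← hnorm_inv]; simp
  dist_triangle p q r := by
    have h := hnorm_mul_le (r⁻¹ * q) (q⁻¹ * p)
    rw [mul_assoc, mul_inv_cancel_left] at h
    linarith
  eq_of_dist_eq_zero := by
    intro p q h
    have h0 : hnorm (q⁻¹ * p) = 0 := h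
    have h1 : (q⁻¹ * p).z = 0 := by
      have := norm_z_le (q⁻¹ * p)
      rw [h0] at this
      exact norm_le_zero_iff.1 this
    have h2 : (q⁻¹ * p).t = 0 := by
      have := abs_t_le (q⁻¹ * p)
      rw [h0] at this
      exact abs_nonpos_iff.1 (by simpa using this)
    have h3 : q⁻¹ * p = 1 := Heis.ext h1 h2
    exact (inv_mul_eq_one.1 h3).symm

theorem dist_def (p q : Heis) : dist p q = hnorm (q⁻¹ * p) := rfl

instance : MeasurableSpace Heis := borel Heis
instance : BorelSpace Heis := ⟨rfl⟩

/-- The line `V = ℝ u` through the origin of `ℂ` with unit direction `u`.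
Every line through the origin is of this form; `u` and `-u` give the same line. -/
def line (u : Circle) : Submodule ℝ ℂ := Submodule.span ℝ {(u : ℂ)}

/-- The vertical subgroup `W = V × ℝ`, where `V = ℝ u`. -/
def vertical (u : Circle) : Subgroup Heis where
  carrier := {p | p.z ∈ line u}
  mul_mem' := by
    intro p q hp hq
    exact (line u).add_mem hp hq
  one_mem' := (line u).zero_mem
  inv_mem' := by
    intro p hp
    exact (line u).neg_mem hp

/-- The horizontal subgroup `Vᗮ × {0}` complementary to `W = V × ℝ`, as a set. -/
def horizontal (u : Circle) : Set Heis := {p | p.z ∈ (line u)ᗮ ∧ p.t = 0}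

/-- The vertical projection `π_W`: `p = π_W(p) * π_V(p)` with `π_W(p) ∈ W`. -/
def projW (u : Circle) (p : Heis) : Heis :=
  ⟨(line u).starProjection p.z,
    p.t - 2 * omega ((line u).starProjection p.z) ((line u)ᗮ.starProjection p.z)⟩

/-- The horizontal projection `π_V` onto the complementary horizontal subgroup. -/
def projV (u : Circle) (p : Heis) : Heis := ⟨(line u)ᗮ.starProjection p.z, 0⟩

/-- `projW` and `projV` are the components of the splitting `p = p_W * p_V`,
and this splitting is unique. -/
theorem splitting_iff (u : Circle) (p w v : Heis) :
    (w ∈ vertical u ∧ v ∈ horizontal u ∧ p = w * v) ↔ (w = projW u p ∧ v = projV u p) := by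
  constructor
  · rintro ⟨hw, ⟨hv, hvt⟩, rfl⟩
    have hw' : w.z ∈ line u := hw
    have e1 : (line u).starProjection (w * v).z = w.z := by
      rw [mul_z, map_add, Submodule.starProjection_eq_self_iff.2 hw',
        (Submodule.starProjection_apply_eq_zero_iff _).2 hv, add_zero]
    have e2 : (line u)ᗮ.starProjection (w * v).z = v.z := by
      rw [Submodule.starProjection_orthogonal_val, e1, mul_z, add_sub_cancel_left]
    constructor
    · ext1
      · exact e1.symm
      · simp only [projW, e1, e2, mul_t, hvt]; ring
    · ext1
      · exact e2.symm
      · exact hvt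
  · rintro ⟨rfl, rfl⟩
    refine ⟨show (projW u p).z ∈ line u from Submodule.starProjection_apply_mem _ _,
      ⟨Submodule.starProjection_apply_mem _ _, rfl⟩, ?_⟩
    ext1
    · simp [projW, projV, Submodule.starProjection_orthogonal_val]
    · simp [projW, projV]

/-- Two-dimensional Lebesgue (outer) measure on the vertical subgroup `W = V × ℝ`, `V = ℝ u`,
under the (Euclidean) isometric identification `(s, τ) ↦ (s u, τ)` of `ℝ²` with `W`. -/
def area (u : Circle) (A : Set Heis) : ℝ≥0∞ :=
  volume {q : ℝ × ℝ | (⟨(q.1 : ℂ) * (u : ℂ), q.2⟩ : Heis) ∈ A}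

/-- The cone `C_W(a) = {p : ‖p_W‖ ≤ a ‖p_V‖}`. -/
def cone (u : Circle) (a : ℝ) : Set Heis := {p | hnorm (projW u p) ≤ a * hnorm (projV u p)}

/-- `Γ` is an intrinsic `L`-Lipschitz graph over the vertical subgroup `W = ℝ u × ℝ`:
`(x * C_W(a)) ∩ Γ = {x}` for all `x ∈ Γ` and `0 < a < 1 / L`. -/
def IsIntrinsicLipGraph (u : Circle) (L : ℝ) (Γ : Set Heis) : Prop :=
  ∀ x ∈ Γ, ∀ a : ℝ, 0 < a → a < 1 / L → ((fun p => x * p) '' cone u a) ∩ Γ = {x}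

/-- `E` is closed and `3`-(Ahlfors-David)-regular with regularity constant `C`. -/
structure IsRegular3 (E : Set Heis) (C : ℝ) : Prop where
  isClosed : IsClosed E
  one_le : 1 ≤ C
  lower : ∀ x ∈ E, ∀ r : ℝ, 0 < r → ENNReal.ofReal r ≤ Metric.ediam E →
    ENNReal.ofReal (C⁻¹ * r ^ 3) ≤ μH[3] (Metric.closedBall x r ∩ E)
  upper : ∀ x ∈ E, ∀ r : ℝ, 0 < r → ENNReal.ofReal r ≤ Metric.ediam E →
    μH[3] (Metric.closedBall x r ∩ E) ≤ ENNReal.ofReal (C * r ^ 3)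

/-- `β_E(B(x, r); z W) = sup {dist(y, z W) / r : y ∈ B(x, r) ∩ E}`. -/
def betaPlane (E : Set Heis) (x : Heis) (r : ℝ) (z : Heis) (u : Circle) : ℝ≥0∞ :=
  ⨆ y ∈ Metric.closedBall x r ∩ E,
    Metric.infEDist y ((fun w => z * w) '' (vertical u : Set Heis)) / ENNReal.ofReal r

/-- The vertical `β`-number of the ball `B(x, r)`: the infimum of `β_E(B(x, r); z W)`
over all vertical subgroups `W` and all `z`. -/
def beta (E : Set Heis) (x : Heis) (r : ℝ) : ℝ≥0∞ :=
  ⨅ (u : Circle) (z : Heis), betaPlane E x r z u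

/-- The weak geometric lemma for vertical `β`-numbers, with constants `γ(ε)`:
`∫_0^R H³({y ∈ E ∩ B(x, R) : β(B(y, s)) > ε}) ds / s ≤ γ(ε) R³`
for all `ε > 0`, `x ∈ E` and `R > 0`. -/
def WGL (E : Set Heis) (γ : ℝ → ℝ≥0) : Prop :=
  ∀ ε : ℝ, 0 < ε → ∀ x ∈ E, ∀ R : ℝ, 0 < R →
    ∫⁻ s in Ioo 0 R,
        μH[3] {y | y ∈ E ∩ Metric.closedBall x R ∧ ENNReal.ofReal ε < beta E y s} /
          ENNReal.ofReal s
      ≤ γ ε * ENNReal.ofReal (R ^ 3)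

/-- `Δ j`, `j ∈ ℤ`, is a system of David cubes of `E` with constant `c`: nested partitions
of `E` into sets of diameter at most `2 ^ j` which contain a set `B(z, c 2 ^ j) ∩ E`, with `z`
in the cube. -/
structure IsDavidSystem (E : Set Heis) (c : ℝ) (Δ : ℤ → Set (Set Heis)) : Prop where
  c_pos : 0 < c
  sUnion_eq : ∀ j, ⋃₀ Δ j = E
  nonempty : ∀ j, ∀ Q ∈ Δ j, Q.Nonempty
  disjoint : ∀ j, (Δ j).PairwiseDisjoint id
  nested : ∀ j k, j ≤ k → ∀ Q ∈ Δ j, ∀ Q' ∈ Δ k, Q ∩ Q' = ∅ ∨ Q ⊆ Q'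
  diam_le : ∀ j, ∀ Q ∈ Δ j, Metric.ediam Q ≤ ENNReal.ofReal ((2 : ℝ) ^ j)
  ball_subset : ∀ j, ∀ Q ∈ Δ j, ∃ z ∈ Q, Metric.closedBall z (c * (2 : ℝ) ^ j) ∩ E ⊆ Q

end Heis

end

/-! Let x, y in E satisfy r < d(x, y) ≤ 2r. If β is small on B(x, 2r), then E ∩ B(x, 2r) lies in a
thin strip around a translate of some vertical plane W'. If W' is nearly orthogonal to W, then E is
thin along W near x and the projection of E ∩ B(x, r) has area at most 30δr³. Otherwise y lies
outside every cone x · C_W(a) with a < δ/2 (`area_le_or_notMem_cone`).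

Two sets are therefore discarded from Q₀. Points in a cube whose projection has area at most 30δ
times the cube of its scale: the maximal such cubes are disjoint, so their projections add up to at
most a multiple of δ H³(Q₀) (`area_thin_le`). Points in more than M bad cubes, a cube being bad if β
is large on a ball near it: the WGL bounds the total measure of bad cubes (`tsum_badSet_le`),
Chebyshev gains a factor 1/M, and projection costs at most a factor 6 (`area_projW_le_hausdorff`).

Each remaining point has at most M bad cubes, and each cube has at most N neighbours. This allows
words of length M over N + 1 letters such that points in different neighbouring bad cubes of one
level get different words (`exists_coding`). Two points with the same word at distance about 2^k lie
in different cubes of level k, so β is small there; their cubes are not thin, so the cone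
alternative holds. Hence each word defines an intrinsic Lipschitz graph (`exists_graphs`). -/

noncomputable section

/-! ### Coordinates adapted to a vertical subgroup -/

namespace Heis

/-- The coordinate of `p` along the line `ℝ u`. -/
def along (u : Circle) (p : Heis) : ℝ := (conj (u : ℂ) * p.z).re

/-- The coordinate of `p` orthogonal to the line `ℝ u`. -/
def across (u : Circle) (p : Heis) : ℝ := (conj (u : ℂ) * p.z).im

/-- The planar coordinates of the vertical projection of `p`. -/
def planeCoord (u : Circle) (p : Heis) : ℝ × ℝ := (along u p, p.t - along u p * across u p / 2)

theorem along_eq (u : Circle) (p : Heis) :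
    along u p = (u : ℂ).re * p.z.re + (u : ℂ).im * p.z.im := by
  simp [along]

theorem across_eq (u : Circle) (p : Heis) :
    across u p = (u : ℂ).re * p.z.im - (u : ℂ).im * p.z.re := by
  simp [across]; ring

theorem circle_sq (u : Circle) : (u : ℂ).re ^ 2 + (u : ℂ).im ^ 2 = 1 := by
  have h := Circle.normSq_coe u
  rw [Complex.normSq_apply] at h
  linarith

theorem z_decomp (u : Circle) (p : Heis) :
    p.z = (along u p : ℂ) * u + (across u p : ℂ) * (Complex.I * u) := by
  have h := circle_sq u
  apply Complex.ext
  · simp only [along_eq, across_eq, Complex.add_re, Complex.mul_re, Complex.ofReal_re,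
      Complex.ofReal_im, Complex.I_re, Complex.I_im, Complex.mul_im]
    linear_combination (-p.z.re) * h
  · simp only [along_eq, across_eq, Complex.add_im, Complex.mul_re, Complex.ofReal_re,
      Complex.ofReal_im, Complex.I_re, Complex.I_im, Complex.mul_im]
    linear_combination (-p.z.im) * h

theorem starProjection_line (u : Circle) (p : Heis) :
    (line u).starProjection p.z = (along u p : ℂ) * u := by
  rw [line, Submodule.starProjection_unit_singleton ℝ (Circle.norm_coe u), Complex.inner,
    Complex.real_smul, along, mul_comm p.z]

theorem starProjection_line_orthogonal (u : Circle) (p : Heis) :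
    (line u)ᗮ.starProjection p.z = (across u p : ℂ) * (Complex.I * u) := by
  rw [Submodule.starProjection_orthogonal_val, starProjection_line]
  nth_rewrite 1 [z_decomp u p]
  ring

theorem projW_eq (u : Circle) (p : Heis) :
    projW u p = ⟨((planeCoord u p).1 : ℂ) * u, (planeCoord u p).2⟩ := by
  have h := circle_sq u
  ext1
  · simp [projW, planeCoord, starProjection_line]
  · simp only [projW, planeCoord, starProjection_line, starProjection_line_orthogonal, omega_eq,
      Complex.mul_re, Complex.ofReal_re, Complex.ofReal_im, Complex.I_re, Complex.I_im,
      Complex.mul_im]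
    linear_combination (-(along u p * across u p / 2)) * h

theorem hnorm_projV (u : Circle) (p : Heis) : hnorm (projV u p) = |across u p| := by
  simp only [hnorm, projV, starProjection_line_orthogonal]
  simp [Circle.norm_coe]

theorem abs_along_le_hnorm_projW (u : Circle) (p : Heis) : |along u p| ≤ hnorm (projW u p) := by
  refine Eq.trans_le ?_ (norm_z_le (projW u p))
  simp [projW, starProjection_line, Circle.norm_coe]

theorem hnorm_le_projW_add_projV (u : Circle) (p : Heis) :
    hnorm p ≤ hnorm (projW u p) + hnorm (projV u p) := by
  have h := ((splitting_iff u p (projW u p) (projV u p)).2 ⟨rfl, rfl⟩).2.2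
  calc hnorm p = hnorm (projW u p * projV u p) := by rw [← h]
    _ ≤ _ := hnorm_mul_le _ _

theorem area_projW_image (u : Circle) (S : Set Heis) :
    area u (projW u '' S) = volume (planeCoord u '' S) := by
  unfold area
  congr 1
  ext q
  simp only [mem_ofPred_eq, mem_image]
  refine exists_congr fun p => and_congr_right fun _ => ?_
  rw [projW_eq]
  constructor
  · intro h
    have h1 := congrArg Heis.z h
    have h2 := congrArg Heis.t h
    have h3 := mul_right_cancel₀ (Circle.coe_ne_zero u) h1
    exact Prod.ext (by exact_mod_cast h3) h2
  · rintro rfl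
    rfl

theorem area_mono (u : Circle) {S T : Set Heis} (h : S ⊆ T) : area u S ≤ area u T :=
  measure_mono fun _ hq => h hq

theorem area_union_le (u : Circle) (S T : Set Heis) : area u (S ∪ T) ≤ area u S + area u T :=
  measure_union_le _ _

theorem area_projW_iUnion_le (u : Circle) {ι : Type*} [Countable ι] (S : ι → Set Heis) :
    area u (projW u '' ⋃ i, S i) ≤ ∑' i, area u (projW u '' S i) := by
  rw [area_projW_image, image_iUnion]
  simp only [area_projW_image]
  exact measure_iUnion_le (μ := (volume : Measure (ℝ × ℝ))) fun i => planeCoord u '' S i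

theorem abs_along_le (u : Circle) (p : Heis) : |along u p| ≤ hnorm p := by
  refine (Complex.abs_re_le_norm _).trans ?_
  simpa [Circle.norm_coe] using norm_z_le p

theorem abs_across_le (u : Circle) (p : Heis) : |across u p| ≤ hnorm p := by
  refine (Complex.abs_im_le_norm _).trans ?_
  simpa [Circle.norm_coe] using norm_z_le p

theorem along_inv_mul (u : Circle) (x y : Heis) :
    along u (x⁻¹ * y) = along u y - along u x := by
  simp [along_eq]; ring

theorem across_inv_mul (u : Circle) (x y : Heis) :
    across u (x⁻¹ * y) = across u y - across u x := by
  simp [across_eq]; ring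

/-! ### Area of vertical projections -/

/-- Left translations act on planar coordinates by shears and translations. -/
theorem planeCoord_snd_sub (u : Circle) (x y : Heis) :
    (planeCoord u y).2 - ((planeCoord u x).2 - across u x * (along u y - along u x)) =
      (x⁻¹ * y).t - along u (x⁻¹ * y) * across u (x⁻¹ * y) / 2 := by
  have h := circle_sq u
  rw [along_inv_mul, across_inv_mul]
  simp only [planeCoord, mul_t, inv_t, inv_z, omega_eq, along_eq, across_eq, Complex.neg_re,
    Complex.neg_im]
  linear_combination ((x.z.im * y.z.re - x.z.re * y.z.im) / 2) * h

/-- The shear only moves the centres of the vertical slices, which are intervals of length `2 * h`.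
-/
theorem volume_sheared_rectangle_le (s₀ τ₀ m δ h : ℝ) :
    volume {q : ℝ × ℝ | |q.1 - s₀| ≤ δ ∧ |q.2 - (τ₀ - m * (q.1 - s₀))| ≤ h} ≤
      ENNReal.ofReal (2 * h) * ENNReal.ofReal (2 * δ) := by
  have hcl : IsClosed {q : ℝ × ℝ | |q.1 - s₀| ≤ δ ∧ |q.2 - (τ₀ - m * (q.1 - s₀))| ≤ h} :=
    IsClosed.inter (s₁ := {q : ℝ × ℝ | |q.1 - s₀| ≤ δ})
      (s₂ := {q : ℝ × ℝ | |q.2 - (τ₀ - m * (q.1 - s₀))| ≤ h})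
      (isClosed_le (by fun_prop) (by fun_prop)) (isClosed_le (by fun_prop) (by fun_prop))
  rw [Measure.volume_eq_prod, Measure.prod_apply hcl.measurableSet]
  calc ∫⁻ s, volume (Prod.mk s ⁻¹'
          {q : ℝ × ℝ | |q.1 - s₀| ≤ δ ∧ |q.2 - (τ₀ - m * (q.1 - s₀))| ≤ h})
      ≤ ∫⁻ s, (Icc (s₀ - δ) (s₀ + δ)).indicator (fun _ => ENNReal.ofReal (2 * h)) s := by
        refine lintegral_mono fun s => ?_
        by_cases hs : s ∈ Icc (s₀ - δ) (s₀ + δ)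
        · rw [indicator_of_mem hs]
          calc _ ≤ volume (Icc (τ₀ - m * (s - s₀) - h) (τ₀ - m * (s - s₀) + h)) := by
                refine measure_mono ?_
                rintro τ ⟨-, hτ⟩
                have := abs_le.1 hτ
                simp only at this
                constructor <;> linarith
            _ = _ := by rw [Real.volume_Icc]; congr 1; ring
        · rw [indicator_of_notMem hs, nonpos_iff_eq_zero]
          convert measure_empty (μ := (volume : Measure ℝ))
          ext τ
          simp only [mem_preimage, mem_ofPred_eq, mem_empty_iff_false, iff_false, not_and]
          intro h1
          have := abs_le.1 h1
          exact absurd ⟨by linarith, by linarith⟩ hs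
    _ = _ := by
        rw [lintegral_indicator measurableSet_Icc, setLIntegral_const, Real.volume_Icc]
        congr 2; ring

/-- A set within distance `r` of `x` which is thin along `ℝ u` has small vertical projection. -/
theorem area_projW_le_of_along_le (u : Circle) {S : Set Heis} {x : Heis} {δ r : ℝ}
    (hδ : ∀ y ∈ S, |along u (x⁻¹ * y)| ≤ δ) (hr : ∀ y ∈ S, dist y x ≤ r) :
    area u (projW u '' S) ≤ ENNReal.ofReal (6 * δ * r ^ 2) := by
  rcases S.eq_empty_or_nonempty with rfl | ⟨y₀, hy₀⟩
  · simp [area]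
  have hδ0 : 0 ≤ δ := (abs_nonneg _).trans (hδ y₀ hy₀)
  rw [area_projW_image]
  calc volume (planeCoord u '' S) ≤ _ := measure_mono ?_
    -- The half-height is r² from the t-coordinate of `x⁻¹ * y` plus r²/2 from half the product of
    -- its two horizontal coordinates.
    _ ≤ _ := volume_sheared_rectangle_le (along u x) (planeCoord u x).2 (across u x) δ
        (3 / 2 * r ^ 2)
    _ = _ := by rw [← ENNReal.ofReal_mul (by positivity)]; congr 1; ring
  rintro _ ⟨y, hy, rfl⟩
  refine ⟨by simpa [along_inv_mul, planeCoord] using hδ y hy, ?_⟩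
  have hd : hnorm (x⁻¹ * y) ≤ r := hr y hy
  have e := planeCoord_snd_sub u x y
  change |(planeCoord u y).2 - ((planeCoord u x).2 - across u x * (along u y - along u x))| ≤ _
  rw [e]
  have h0 := hnorm_nonneg (x⁻¹ * y)
  have h1 := abs_t_le (x⁻¹ * y)
  have h2 : |along u (x⁻¹ * y) * across u (x⁻¹ * y)| ≤ r * r := by
    rw [abs_mul]
    exact mul_le_mul ((abs_along_le _ _).trans hd) ((abs_across_le _ _).trans hd) (abs_nonneg _)
      (h0.trans hd)
  have h3 : hnorm (x⁻¹ * y) ^ 2 ≤ r ^ 2 := by gcongr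
  have h4 := abs_le.1 (h1.trans h3)
  have h5 := abs_le.1 h2
  rw [abs_le]
  constructor <;> nlinarith

theorem area_projW_le_ediam (u : Circle) {S : Set Heis} :
    area u (projW u '' S) ≤ 6 * Metric.ediam S ^ (3 : ℝ) := by
  rcases S.eq_empty_or_nonempty with rfl | ⟨x, hx⟩
  · simp [area]
  by_cases hfin : Metric.ediam S = ⊤
  · simp [hfin]
  have hd : ∀ y ∈ S, dist y x ≤ (Metric.ediam S).toReal := by
    intro y hy
    rw [dist_edist]
    exact ENNReal.toReal_mono hfin (Metric.edist_le_ediam_of_mem hy hx)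
  refine (area_projW_le_of_along_le u (fun y hy => (abs_along_le u _).trans (hd y hy)) hd).trans ?_
  rw [mul_assoc, ENNReal.ofReal_mul (by norm_num), ← pow_succ', ENNReal.ofReal_pow (by positivity),
    ENNReal.ofReal_toReal hfin]
  norm_num

/-- Vertical projections do not increase the Hausdorff measure `H³` by more than a factor. -/
theorem area_projW_le_hausdorff (u : Circle) (S : Set Heis) :
    area u (projW u '' S) ≤ 6 * μH[3] S := by
  have key : area u (projW u '' S) / 6 ≤ μH[3] S := by
    rw [Measure.hausdorffMeasure_apply]
    -- The bound holds for covers by sets of any size, so any scale serves, here 1.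
    refine le_iSup₂_of_le 1 one_pos (le_iInf fun t => le_iInf fun ht => le_iInf fun _ => ?_)
    refine ENNReal.div_le_of_le_mul' ?_
    calc area u (projW u '' S) ≤ area u (projW u '' ⋃ n, t n) := area_mono u (image_mono ht)
      _ ≤ ∑' n, area u (projW u '' t n) := area_projW_iUnion_le u t
      _ ≤ ∑' n, 6 * ⨆ _ : (t n).Nonempty, Metric.ediam (t n) ^ (3 : ℝ) := by
          refine ENNReal.tsum_le_tsum fun n => ?_
          rcases (t n).eq_empty_or_nonempty with h | h
          · simp [h, area]
          · simpa [h] using area_projW_le_ediam u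
      _ = _ := ENNReal.tsum_mul_left
  rwa [ENNReal.div_le_iff_le_mul (by simp) (by simp), mul_comm] at key

/-! ### Cones and β-numbers -/

theorem IsIntrinsicLipGraph.of_forall_notMem {u : Circle} {α : ℝ} {F : Set Heis}
    (h : ∀ x ∈ F, ∀ y ∈ F, x ≠ y → ∀ a, 0 < a → a < α → x⁻¹ * y ∉ cone u a) :
    IsIntrinsicLipGraph u (1 / α) F := by
  intro x hx a ha haα
  rw [one_div_one_div] at haα
  apply Subset.antisymm
  · rintro y ⟨⟨p, hp, rfl⟩, hy⟩
    by_contra hne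
    exact h x hx (x * p) hy (fun e => hne e.symm) a ha haα (by simpa using hp)
  · rintro _ rfl
    refine ⟨⟨1, ?_, mul_one _⟩, hx⟩
    simp [cone, hnorm, projW, projV, omega]

theorem across_eq_zero_of_mem_vertical {u : Circle} {w : Heis} (hw : w ∈ vertical u) :
    across u w = 0 := by
  obtain ⟨s, hs⟩ := Submodule.mem_span_singleton.1 (show w.z ∈ line u from hw)
  rw [across_eq, ← hs]
  simp
  ring

/-- A ball with small vertical `β`-number projects into a thin strip. -/
theorem exists_strip_of_beta_le {E : Set Heis} {x : Heis} (hx : x ∈ E) {ε r : ℝ} (hε : 0 < ε)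
    (hr : 0 < r) (hβ : beta E x r ≤ ENNReal.ofReal ε) :
    ∃ v : Circle, ∀ y ∈ Metric.closedBall x r ∩ E, |across v (x⁻¹ * y)| ≤ 4 * ε * r := by
  -- The infimum need not be attained; the slack 2ε provides an actual plane.
  have h1 : beta E x r < ENNReal.ofReal (2 * ε) :=
    hβ.trans_lt ((ENNReal.ofReal_lt_ofReal_iff (by linarith)).2 (by linarith))
  obtain ⟨v, h2⟩ := iInf_lt_iff.1 h1
  obtain ⟨z, h3⟩ := iInf_lt_iff.1 h2
  have key : ∀ y ∈ Metric.closedBall x r ∩ E, |across v (z⁻¹ * y)| ≤ 2 * ε * r := by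
    intro y hy
    have h4 : Metric.infEDist y ((fun w => z * w) '' (vertical v : Set Heis)) / ENNReal.ofReal r
        < ENNReal.ofReal (2 * ε) := (le_iSup₂ (f := fun y (_ : y ∈ Metric.closedBall x r ∩ E) =>
          Metric.infEDist y ((fun w => z * w) '' (vertical v : Set Heis)) / ENNReal.ofReal r)
          y hy).trans_lt h3
    rw [ENNReal.div_lt_iff (by simp [hr]) (by simp), ← ENNReal.ofReal_mul (by positivity),
      Metric.infEDist_lt_iff] at h4
    obtain ⟨_, ⟨w, hw, rfl⟩, h5⟩ := h4
    rw [edist_dist, ENNReal.ofReal_lt_ofReal_iff (by positivity)] at h5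
    have h6 := (abs_across_le v _).trans h5.le
    rw [across_inv_mul] at h6
    have h7 := across_eq_zero_of_mem_vertical hw
    have h8 : across v (z * w) = across v z + across v w := by simp [across_eq]; ring
    rwa [h8, h7, add_zero, ← across_inv_mul] at h6
  refine ⟨v, fun y hy => ?_⟩
  -- Both y and the centre x are within 2εr of the plane; subtracting eliminates the base point z.
  have a1 := abs_le.1 (key y hy)
  have a2 := abs_le.1 (key x ⟨Metric.mem_closedBall_self hr.le, hx⟩)
  rw [across_inv_mul] at a1 a2 ⊢
  rw [abs_le]
  constructor <;> linarith

/-- Change of coordinates between two orthonormal frames. -/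
theorem across_rotate (u v : Circle) : ∃ p q : ℝ, p ^ 2 + q ^ 2 = 1 ∧
    ∀ w : Heis, across v w = p * across u w + q * along u w := by
  refine ⟨(v : ℂ).re * (u : ℂ).re + (v : ℂ).im * (u : ℂ).im,
    (v : ℂ).re * (u : ℂ).im - (v : ℂ).im * (u : ℂ).re, ?_, fun w => ?_⟩
  · linear_combination ((u : ℂ).re ^ 2 + (u : ℂ).im ^ 2) * circle_sq v + circle_sq u
  · simp only [across_eq, along_eq]
    linear_combination (-((v : ℂ).re * w.z.im - (v : ℂ).im * w.z.re)) * circle_sq u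

/-- In a ball with small `β`-number, either the centre has a neighbourhood with small vertical
projection, or no point at comparable distance lies in the cone at the centre. -/
theorem area_le_or_notMem_cone {E : Set Heis} {x : Heis} (hx : x ∈ E) (u : Circle) {δ r : ℝ}
    (hδ : 0 < δ) (hδ' : δ ≤ 1 / 2) (hr : 0 < r)
    (hβ : beta E x (2 * r) ≤ ENNReal.ofReal (δ / 64)) :
    area u (projW u '' (Metric.closedBall x r ∩ E)) ≤ ENNReal.ofReal (30 * δ * r ^ 3) ∨
      ∀ y ∈ E, r < dist y x → dist y x ≤ 2 * r → ∀ a, 0 < a → a < δ / 2 → x⁻¹ * y ∉ cone u a := by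
  obtain ⟨v, hv⟩ := exists_strip_of_beta_le hx (by positivity) (by positivity) hβ
  obtain ⟨p, q, hpq, hrot⟩ := across_rotate u v
  have hstrip : ∀ y ∈ E, dist y x ≤ 2 * r →
      |p * across u (x⁻¹ * y) + q * along u (x⁻¹ * y)| ≤ δ / 8 * r := by
    intro y hy hyr
    have := hv y ⟨hyr, hy⟩
    rw [hrot] at this
    linarith
  -- Here |p| is the cosine of the angle between the lines of u and v.
  by_cases hp : |p| ≤ δ
  · left
    have hq : 1 / 2 ≤ |q| := by
      have h1 : |p| ^ 2 ≤ (1 / 2) ^ 2 := by gcongr; linarith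
      rw [sq_abs] at h1
      refine le_of_sq_le_sq ?_ (abs_nonneg _)
      rw [sq_abs]
      linarith
    -- Since |q| ≥ 1/2, the strip gives |along| ≤ (9/4)δr, rounded up to 5δr.
    refine (area_projW_le_of_along_le u (x := x) (δ := 5 * δ * r) (r := r) ?_
      fun y hy => hy.1).trans_eq (by congr 1; ring)
    rintro y ⟨hyr, hy⟩
    have hyr : dist y x ≤ r := hyr
    have h1 := hstrip y hy (by linarith)
    have h2 : |q * along u (x⁻¹ * y)| ≤ δ / 8 * r + |p * across u (x⁻¹ * y)| := by
      have := abs_sub (p * across u (x⁻¹ * y) + q * along u (x⁻¹ * y)) (p * across u (x⁻¹ * y))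
      rw [add_sub_cancel_left] at this
      linarith
    have h3 : |p * across u (x⁻¹ * y)| ≤ δ * r := by
      rw [abs_mul]
      exact mul_le_mul hp ((abs_across_le _ _).trans hyr) (abs_nonneg _) hδ.le
    rw [abs_mul] at h2
    have h4 := mul_le_mul_of_nonneg_right hq (abs_nonneg (along u (x⁻¹ * y)))
    nlinarith [mul_pos hδ hr]
  · right
    -- A point of the cone at distance more than r has |across| > r/2, while the strip gives
    -- (δ/2)|across| ≤ δr/8.
    intro y hy hry hy2r a ha haδ hcone
    have h1 : hnorm (projW u (x⁻¹ * y)) ≤ a * hnorm (projV u (x⁻¹ * y)) := hcone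
    have h2 := hnorm_le_projW_add_projV u (x⁻¹ * y)
    have h3 : r < hnorm (x⁻¹ * y) := hry
    have h4 := abs_along_le_hnorm_projW u (x⁻¹ * y)
    rw [hnorm_projV] at h1 h2
    have h5 := hstrip y hy hy2r
    have h6 : |p| * |across u (x⁻¹ * y)| ≤ δ / 8 * r + |q| * |along u (x⁻¹ * y)| := by
      rw [← abs_mul, ← abs_mul]
      have := abs_sub (p * across u (x⁻¹ * y) + q * along u (x⁻¹ * y)) (q * along u (x⁻¹ * y))
      rw [add_sub_cancel_right] at this
      linarith
    have hq : |q| ≤ 1 := abs_le_one_iff_mul_self_le_one.2 (by nlinarith [sq_nonneg p])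
    have h7 : |q| * |along u (x⁻¹ * y)| ≤ δ / 2 * |across u (x⁻¹ * y)| := by
      calc |q| * |along u (x⁻¹ * y)| ≤ 1 * |along u (x⁻¹ * y)| := by gcongr
        _ ≤ a * |across u (x⁻¹ * y)| := by linarith
        _ ≤ _ := by gcongr
    have h8 : δ * |across u (x⁻¹ * y)| ≤ |p| * |across u (x⁻¹ * y)| := by
      have := (not_le.1 hp).le
      gcongr
    have h9 : r / 2 < |across u (x⁻¹ * y)| := by
      have : a * |across u (x⁻¹ * y)| ≤ 1 * |across u (x⁻¹ * y)| := by gcongr; linarith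
      linarith
    nlinarith

end Heis

/-! ### Coding by words of bounded length -/

/-- Greedy colouring along a well-order. -/
theorem exists_greedy_coloring {V : Type*} (r : V → V → Prop) (hr : WellFounded r)
    (adj : V → V → Prop) (N : ℕ) (hN : ∀ v, {w | r w v ∧ adj v w}.encard ≤ N) :
    ∃ col : V → Fin (N + 1), ∀ v w, r w v → adj v w → col v ≠ col w := by
  classical
  have step : ∀ v (f : ∀ w, r w v → Fin (N + 1)), ∃ k : Fin (N + 1),
      ∀ w (h : r w v), adj v w → k ≠ f w h := by
    intro v f
    -- If all N + 1 colours were excluded, choosing an excluding neighbour for each would be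
    -- injective.
    by_contra! hcon
    choose g hg hadj heq using hcon
    have hinj : Function.Injective g := fun k l hkl => by
      rw [heq k, heq l]
      congr 1
    have h1 : (range g).encard ≤ N :=
      (encard_le_encard (by rintro _ ⟨k, rfl⟩; exact ⟨hg k, hadj k⟩)).trans (hN v)
    rw [← image_univ, hinj.encard_image, encard_univ, ENat.card_eq_coe_fintype_card,
      Fintype.card_fin] at h1
    have h2 : N + 1 ≤ N := by exact_mod_cast h1
    omega
  choose g hg using step
  refine ⟨hr.fix g, fun v w hwv hadj => ?_⟩
  rw [hr.fix_eq g v]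
  exact hg v _ w hwv hadj

/-- Points are coded by words of bounded length so that close points in different cells of a
level which is bad for both of them get different codes. -/
theorem exists_coding {X ι : Type*} (q : ℕ → X → ι) (bad : X → ℕ → Prop) (nb : ℕ → X → X → Prop)
    (M N : ℕ)
    (hq : ∀ m n, m ≤ n → ∀ x y, q n x = q n y → q m x = q m y)
    (hbad : ∀ n x y, q n x = q n y → (bad x n ↔ bad y n))
    (hnb : ∀ n x y, nb n x y → nb n y x)
    (hN : ∀ n x, {Q | ∃ x' y, q n x' = q n x ∧ nb n x' y ∧ q n y = Q}.encard ≤ N)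
    (hM : ∀ x n, (open scoped Classical in Nat.count (bad x) n) ≤ M) :
    ∃ col : X → (Fin M → Fin (N + 1)), ∀ n x y, nb n x y → q n x ≠ q n y → bad x n → bad y n →
      col x ≠ col y := by
  classical
  have hcount : ∀ n x y, q n x = q n y → Nat.count (bad x) n = Nat.count (bad y) n := by
    intro n x y h
    rw [Nat.count_eq_card_filter_range, Nat.count_eq_card_filter_range]
    congr 1
    refine Finset.filter_congr fun m hm => ?_
    exact hbad m x y (hq m n (Finset.mem_range.1 hm).le x y h)
  have hlevel : ∀ n y i, bad y n → i ≤ Nat.count (bad y) n → Nat.nth (bad y) i ≤ n := by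
    intro n y i hy hi
    rcases hi.lt_or_eq with h | rfl
    · exact (Nat.nth_lt_of_lt_count h).le
    · exact (Nat.nth_count hy).le
  -- Coarse levels are coloured first; a well-order breaks ties within a level.
  let r : ℕ × ι → ℕ × ι → Prop := Prod.Lex (· < ·) WellOrderingRel
  have hr : WellFounded r := WellFounded.prod_lex Nat.lt_wfRel.wf IsWellFounded.wf
  -- The i-th letter of a point (counted from 0) is the colour of its i-th bad cell. If n is the
  -- i-th bad level of x and y has at least i bad levels before n, the i-th bad level of y is at
  -- most n. Its cell there must get another colour.
  let adj : ℕ × ι → ℕ × ι → Prop := fun v w => ∃ x y, q v.1 x = v.2 ∧ nb v.1 x y ∧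
    q v.1 y ≠ q v.1 x ∧ bad x v.1 ∧ bad y v.1 ∧ Nat.count (bad x) v.1 ≤ Nat.count (bad y) v.1 ∧
    w.1 = Nat.nth (bad y) (Nat.count (bad x) v.1) ∧ w.2 = q w.1 y
  obtain ⟨col, hcol⟩ := exists_greedy_coloring r hr adj N (by
    rintro ⟨n, Q⟩
    by_cases hne : ∃ x, q n x = Q
    · obtain ⟨x₀, rfl⟩ := hne
      let i := Nat.count (bad x₀) n
      let S := {Q | ∃ x' y, q n x' = q n x₀ ∧ nb n x' y ∧ bad y n ∧ i ≤ Nat.count (bad y) n ∧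
        q n y = Q}
      have hS : S.encard ≤ N := (encard_le_encard (by
        rintro P ⟨x', y, h1, h2, -, -, h3⟩
        exact ⟨x', y, h1, h2, h3⟩)).trans (hN n x₀)
      -- The i-th bad cell of y is determined by its cell at level n, so there are at most N such
      -- constraints.
      have hrep : ∀ P ∈ S, ∃ w : ℕ × ι, ∀ y, bad y n → i ≤ Nat.count (bad y) n → q n y = P →
          (Nat.nth (bad y) i, q (Nat.nth (bad y) i) y) = w := by
        rintro P ⟨-, y, -, -, hy, hiy, rfl⟩
        refine ⟨(Nat.nth (bad y) i, q (Nat.nth (bad y) i) y), fun y' hy' hiy' hP => ?_⟩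
        have hnth : Nat.nth (bad y') i = Nat.nth (bad y) i := by
          have e := hcount n y' y hP
          rcases hiy.lt_or_eq with h | h
          · have hb : ∀ m, m < n → (bad y' m ↔ bad y m) := fun m hm =>
              hbad m y' y (hq m n hm.le y' y hP)
            have hcard : ∀ hf : {m | bad y m}.Finite, i < hf.toFinset.card := fun hf =>
              h.trans_le (Nat.count_le_card hf n)
            have hlt := Nat.nth_lt_of_lt_count h
            have e' : Nat.count (bad y') (Nat.nth (bad y) i) = i :=
              (hcount _ y' y (hq _ n hlt.le y' y hP)).trans (Nat.count_nth hcard)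
            have := Nat.nth_count ((hb _ hlt).2 (Nat.nth_mem i hcard))
            rwa [e'] at this
          · have h' : i = Nat.count (bad y') n := h.trans e.symm
            rw [h', Nat.nth_count hy', ← h', h, Nat.nth_count hy]
        rw [hnth, hq _ n (hlevel n y i hy hiy) y' y hP]
      choose! f hf using hrep
      refine le_trans (encard_le_encard (t := f '' S) ?_) ((encard_image_le f S).trans hS)
      rintro ⟨m, P⟩ ⟨-, x, y, h1, h2, -, -, h4, h5, h6, h7⟩
      have e : Nat.count (bad x) n = i := hcount n x x₀ h1
      simp only at h1 h2 h4 h5 h6 h7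
      rw [e] at h5 h6
      have hy : q n y ∈ S := ⟨x, y, h1, h2, h4, h5, rfl⟩
      refine ⟨q n y, hy, ?_⟩
      rw [← hf _ hy y h4 h5 rfl, h7, h6]
    · rw [encard_eq_zero.2 _]
      · simp
      · rw [eq_empty_iff_forall_notMem]
        rintro w ⟨-, x, -, h, -⟩
        exact hne ⟨x, h⟩)
  have key : ∀ n x y, nb n x y → q n x ≠ q n y → bad x n → bad y n →
      Nat.count (bad x) n ≤ Nat.count (bad y) n →
      ∃ i < M, col (Nat.nth (bad x) i, q (Nat.nth (bad x) i) x) ≠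
        col (Nat.nth (bad y) i, q (Nat.nth (bad y) i) y) := by
    intro n x y hxy hne hx hy hle
    refine ⟨Nat.count (bad x) n, ?_, ?_⟩
    · have := hM x (n + 1)
      rw [Nat.count_succ, if_pos hx] at this
      omega
    rw [Nat.nth_count hx]
    set m := Nat.nth (bad y) (Nat.count (bad x) n) with hm
    have hadj : adj (n, q n x) (m, q m y) := ⟨x, y, rfl, hxy, hne.symm, hx, hy, hle, rfl, rfl⟩
    rcases hle.lt_or_eq with hlt | heq
    · exact hcol _ _ (Prod.Lex.left _ _ (Nat.nth_lt_of_lt_count hlt)) hadj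
    · have hmn : m = n := by rw [hm, heq, Nat.nth_count hy]
      rw [hmn] at hadj ⊢
      have hadj' : adj (n, q n y) (n, q n x) :=
        ⟨y, x, rfl, hnb _ _ _ hxy, hne, hy, hx, heq.ge, by rw [← heq, Nat.nth_count hx], rfl⟩
      -- With equal counts both cells have level n and are mutually adjacent; the later one avoids
      -- the colour of the earlier.
      rcases trichotomous_of WellOrderingRel (q n x) (q n y) with h | h | h
      · exact (hcol _ _ (Prod.Lex.right _ h) hadj').symm
      · exact absurd h hne
      · exact hcol _ _ (Prod.Lex.right _ h) hadj
  refine ⟨fun x i => col (Nat.nth (bad x) i, q (Nat.nth (bad x) i) x), ?_⟩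
  intro n x y hxy hne hx hy heq
  rcases le_total (Nat.count (bad x) n) (Nat.count (bad y) n) with h | h
  · obtain ⟨i, hi, hcon⟩ := key n x y hxy hne hx hy h
    exact hcon (congrFun heq ⟨i, hi⟩)
  · obtain ⟨i, hi, hcon⟩ := key n y x (hnb _ _ _ hxy) hne.symm hy hx h
    exact hcon (congrFun heq ⟨i, hi⟩).symm

/-! ### Regular sets and David cubes -/

namespace Heis

/-- Beyond the diameter nothing is gained: E is already contained in the ball of radius diam E. -/
theorem IsRegular3.measure_le {E : Set Heis} {C : ℝ} (hE : IsRegular3 E C)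
    (hE0 : 0 < Metric.ediam E) {x : Heis} (hx : x ∈ E) {r : ℝ} (hr : 0 < r) :
    μH[3] (Metric.closedBall x r ∩ E) ≤ ENNReal.ofReal (C * r ^ 3) := by
  by_cases h : ENNReal.ofReal r ≤ Metric.ediam E
  · exact hE.upper x hx r hr h
  have hlt := not_le.1 h
  have hfin : Metric.ediam E ≠ ⊤ := hlt.ne_top
  have hD : 0 < (Metric.ediam E).toReal := ENNReal.toReal_pos hE0.ne' hfin
  have hDr : (Metric.ediam E).toReal ≤ r := ENNReal.toReal_le_of_le_ofReal hr.le hlt.le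
  have hC := hE.one_le
  calc μH[3] (Metric.closedBall x r ∩ E)
      ≤ μH[3] (Metric.closedBall x (Metric.ediam E).toReal ∩ E) := by
        refine measure_mono fun y hy => ⟨?_, hy.2⟩
        rw [Metric.mem_closedBall, dist_edist]
        exact ENNReal.toReal_mono hfin (Metric.edist_le_ediam_of_mem hy.2 hx)
    _ ≤ _ := hE.upper x hx _ hD (ENNReal.ofReal_toReal hfin).le
    _ ≤ _ := by
        refine ENNReal.ofReal_le_ofReal ?_
        gcongr

/-- The cube of level `k` which contains `x`. -/
def cubeAt (Δ : ℤ → Set (Set Heis)) (k : ℤ) (x : Heis) : Set Heis := ⋃₀ {Q ∈ Δ k | x ∈ Q}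

section Cubes

variable {E : Set Heis} {C c : ℝ} {Δ : ℤ → Set (Set Heis)}

theorem IsDavidSystem.subset (hΔ : IsDavidSystem E c Δ) {k : ℤ} {Q : Set Heis} (hQ : Q ∈ Δ k) :
    Q ⊆ E := by
  rw [← hΔ.sUnion_eq k]
  exact subset_sUnion_of_mem hQ

theorem IsDavidSystem.cubeAt_eq (hΔ : IsDavidSystem E c Δ) {k : ℤ} {Q : Set Heis} (hQ : Q ∈ Δ k)
    {x : Heis} (hx : x ∈ Q) : cubeAt Δ k x = Q := by
  apply Subset.antisymm
  · apply sUnion_subset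
    rintro P ⟨hP, hxP⟩
    rw [(hΔ.disjoint k).elim_set hP hQ x hxP hx]
  · exact subset_sUnion_of_mem ⟨hQ, hx⟩

theorem IsDavidSystem.cubeAt_mem (hΔ : IsDavidSystem E c Δ) (k : ℤ) {x : Heis} (hx : x ∈ E) :
    cubeAt Δ k x ∈ Δ k ∧ x ∈ cubeAt Δ k x := by
  rw [← hΔ.sUnion_eq k] at hx
  obtain ⟨Q, hQ, hxQ⟩ := hx
  rw [hΔ.cubeAt_eq hQ hxQ]
  exact ⟨hQ, hxQ⟩

theorem IsDavidSystem.cubeAt_congr (hΔ : IsDavidSystem E c Δ) {k : ℤ} {x y : Heis} (hx : x ∈ E)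
    (hy : y ∈ cubeAt Δ k x) : cubeAt Δ k y = cubeAt Δ k x :=
  hΔ.cubeAt_eq (hΔ.cubeAt_mem k hx).1 hy

theorem IsDavidSystem.subset_of_mem (hΔ : IsDavidSystem E c Δ) {k j : ℤ} (hkj : k ≤ j)
    {Q Q' : Set Heis} (hQ : Q ∈ Δ k) (hQ' : Q' ∈ Δ j) {x : Heis} (hx : x ∈ Q) (hx' : x ∈ Q') :
    Q ⊆ Q' :=
  (hΔ.nested k j hkj Q hQ Q' hQ').resolve_left (Set.Nonempty.ne_empty ⟨x, hx, hx'⟩)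

theorem IsDavidSystem.cubeAt_congr_of_le (hΔ : IsDavidSystem E c Δ) {k j : ℤ} (hkj : k ≤ j)
    {x y : Heis} (hx : x ∈ E) (hy : y ∈ E) (h : cubeAt Δ k x = cubeAt Δ k y) :
    cubeAt Δ j x = cubeAt Δ j y := by
  obtain ⟨h1, h2⟩ := hΔ.cubeAt_mem k hx
  obtain ⟨h3, h4⟩ := hΔ.cubeAt_mem j hx
  have h5 : y ∈ cubeAt Δ k x := h ▸ (hΔ.cubeAt_mem k hy).2
  exact (hΔ.cubeAt_congr hx (hΔ.subset_of_mem hkj h1 h3 h2 h4 h5)).symm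

theorem IsDavidSystem.dist_le (hΔ : IsDavidSystem E c Δ) {k : ℤ} {Q : Set Heis} (hQ : Q ∈ Δ k)
    {x y : Heis} (hx : x ∈ Q) (hy : y ∈ Q) : dist x y ≤ (2 : ℝ) ^ k := by
  have := (Metric.edist_le_ediam_of_mem hx hy).trans (hΔ.diam_le k Q hQ)
  rwa [edist_dist, ENNReal.ofReal_le_ofReal_iff (by positivity)] at this

/-- The factor `min c 1` keeps the radius at most diam E, so that lower regularity applies. The
level k is separate from j because 2^j may exceed diam E. -/
theorem IsDavidSystem.exists_ball (hΔ : IsDavidSystem E c Δ) (hE : IsRegular3 E C) {k j : ℤ}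
    (hkj : k ≤ j) (hk : ENNReal.ofReal (2 ^ k) ≤ Metric.ediam E) {Q : Set Heis} (hQ : Q ∈ Δ j) :
    ∃ z ∈ Q, Metric.closedBall z (min c 1 * 2 ^ k) ∩ E ⊆ Q ∧
      ENNReal.ofReal (C⁻¹ * (min c 1 * 2 ^ k) ^ 3) ≤
        μH[3] (Metric.closedBall z (min c 1 * 2 ^ k) ∩ E) := by
  obtain ⟨z, hz, hzQ⟩ := hΔ.ball_subset j Q hQ
  have hc := hΔ.c_pos
  have hm : 0 < min c 1 := lt_min hc one_pos
  refine ⟨z, hz, Subset.trans ?_ hzQ, hE.lower z (hΔ.subset hQ hz) _ (by positivity) ?_⟩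
  · refine inter_subset_inter_left _ (Metric.closedBall_subset_closedBall ?_)
    have : (2 : ℝ) ^ k ≤ 2 ^ j := zpow_le_zpow_right₀ one_le_two hkj
    exact mul_le_mul (min_le_left _ _) this (by positivity) hc.le
  · refine le_trans (ENNReal.ofReal_le_ofReal ?_) hk
    exact mul_le_of_le_one_left (by positivity) (min_le_right _ _)

theorem IsRegular3.measurableSet_ball (hE : IsRegular3 E C) (z : Heis) (r : ℝ) :
    MeasurableSet (Metric.closedBall z r ∩ E) :=
  (Metric.isClosed_closedBall.inter hE.isClosed).measurableSet

/-- Boundedly many cubes of a given level meet a ball of comparable radius. -/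
theorem IsDavidSystem.encard_le (hΔ : IsDavidSystem E c Δ) (hE : IsRegular3 E C) {k : ℤ}
    (hk : ENNReal.ofReal (2 ^ k) ≤ Metric.ediam E) {x : Heis} (hx : x ∈ E) {ρ : ℝ} (hρ : 0 < ρ)
    {N : ℕ} (hN : C ^ 2 * ((ρ + 1) / min c 1) ^ 3 ≤ N) {S : Set (Set Heis)} (hS : S ⊆ Δ k)
    (hSx : ∀ Q ∈ S, ∃ y ∈ Q, dist y x ≤ ρ * 2 ^ k) : S.encard ≤ N := by
  by_contra hcon
  have hcon' : ((N + 1 : ℕ) : ℕ∞) ≤ S.encard := by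
    push_cast
    exact Order.add_one_le_of_lt (not_le.1 hcon)
  obtain ⟨T, hTS, hT⟩ := Set.exists_subset_encard_eq hcon'
  have hTfin : T.Finite := finite_of_encard_eq_coe hT
  lift T to Finset (Set Heis) using hTfin
  rw [encard_coe_eq_coe_finsetCard] at hT
  have hcard : T.card = N + 1 := by exact_mod_cast hT
  have hc := hΔ.c_pos
  have hm : 0 < min c 1 := lt_min hc one_pos
  have hC : 0 < C := one_pos.trans_le hE.one_le
  have h2 : (0 : ℝ) < 2 ^ k := by positivity
  have hE0 : 0 < Metric.ediam E := (ENNReal.ofReal_pos.2 h2).trans_le hk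
  -- N + 1 disjoint balls of radius l · 2^k, l = `min c 1`, would fit in B(x, (ρ + 1)2^k), against
  -- upper regularity.
  choose! z hz hzQ hzμ using fun Q (hQ : Q ∈ T) => hΔ.exists_ball hE le_rfl hk (hS (hTS hQ))
  have hdisj : (T : Set (Set Heis)).PairwiseDisjoint
      fun Q => Metric.closedBall (z Q) (min c 1 * 2 ^ k) ∩ E := by
    intro Q hQ Q' hQ' hne
    exact (hΔ.disjoint k (hS (hTS hQ)) (hS (hTS hQ')) hne).mono (hzQ Q hQ) (hzQ Q' hQ')
  have hsum : (T.card : ℝ≥0∞) * ENNReal.ofReal (C⁻¹ * (min c 1 * 2 ^ k) ^ 3) ≤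
      ENNReal.ofReal (C * ((ρ + 1) * 2 ^ k) ^ 3) := by
    calc _ ≤ ∑ Q ∈ T, μH[3] (Metric.closedBall (z Q) (min c 1 * 2 ^ k) ∩ E) := by
          rw [← nsmul_eq_mul]
          exact Finset.card_nsmul_le_sum _ _ _ fun Q hQ => hzμ Q hQ
      _ = μH[3] (⋃ Q ∈ T, Metric.closedBall (z Q) (min c 1 * 2 ^ k) ∩ E) :=
          (measure_biUnion_finset hdisj fun Q _ => hE.measurableSet_ball _ _).symm
      _ ≤ μH[3] (Metric.closedBall x ((ρ + 1) * 2 ^ k) ∩ E) := by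
          refine measure_mono (iUnion₂_subset fun Q hQ w hw => ⟨?_, hw.2⟩)
          obtain ⟨y, hy, hyx⟩ := hSx Q (hTS hQ)
          have := hΔ.dist_le (hS (hTS hQ)) (hzQ Q hQ hw) hy
          rw [Metric.mem_closedBall]
          linarith [dist_triangle w y x]
      _ ≤ _ := hE.measure_le hE0 hx (by positivity)
  rw [← ENNReal.ofReal_natCast, ← ENNReal.ofReal_mul (by positivity),
    ENNReal.ofReal_le_ofReal_iff (by positivity), hcard, mul_pow, mul_pow] at hsum
  rw [div_pow, ← mul_div_assoc, div_le_iff₀ (by positivity)] at hN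
  have h3 : ((N + 1 : ℕ) : ℝ) * (C⁻¹ * (min c 1 ^ 3 * (2 ^ k) ^ 3)) * C ≤
      C * ((ρ + 1) ^ 3 * (2 ^ k) ^ 3) * C := mul_le_mul_of_nonneg_right hsum hC.le
  have h4 : ((N + 1 : ℕ) : ℝ) * (C⁻¹ * (min c 1 ^ 3 * (2 ^ k) ^ 3)) * C =
      ((N + 1 : ℕ) : ℝ) * min c 1 ^ 3 * (2 ^ k) ^ 3 := by field_simp
  have h5 : C * ((ρ + 1) ^ 3 * (2 ^ k) ^ 3) * C = C ^ 2 * (ρ + 1) ^ 3 * ((2 : ℝ) ^ k) ^ 3 := by ring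
  rw [h4, h5] at h3
  have h6 := le_of_mul_le_mul_right h3 (by positivity)
  push_cast at h6
  have h7 : 0 < min c 1 ^ 3 := by positivity
  nlinarith

/-! ### Cubes with small projection -/

/-- The points of `Q₀` which lie in a cube with small vertical projection form a set with small
vertical projection. -/
theorem IsDavidSystem.area_thin_le (hΔ : IsDavidSystem E c Δ) (hE : IsRegular3 E C) (u : Circle)
    {j : ℤ} (hj : ENNReal.ofReal (2 ^ j) ≤ Metric.ediam E) {x₀ : Heis} (hx₀ : x₀ ∈ E)
    {Q₀ : Set Heis} (hQ₀ : Q₀ ⊆ E) (hd : ∀ x ∈ Q₀, dist x x₀ ≤ 2 * 2 ^ j) {κ : ℝ} (hκ : 0 ≤ κ) :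
    area u (projW u '' {x ∈ Q₀ | ∃ n : ℕ, area u (projW u '' cubeAt Δ (j - n) x) ≤
      ENNReal.ofReal (κ * (2 ^ (j - n : ℤ)) ^ 3)}) ≤
      ENNReal.ofReal (27 * κ * C ^ 2 / min c 1 ^ 3 * (2 ^ j) ^ 3) := by
  classical
  let thin : Heis → ℕ → Prop := fun x n => area u (projW u '' cubeAt Δ (j - n) x) ≤
      ENNReal.ofReal (κ * (2 ^ (j - n : ℤ)) ^ 3)
  -- The maximal thin cubes: n is the first level at which the cube of x is thin.
  let fam : ℕ → Set (Set Heis) := fun n =>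
    {Q | ∃ x ∈ Q₀, cubeAt Δ (j - n) x = Q ∧ thin x n ∧ ∀ m < n, ¬ thin x m}
  have hlevel : ∀ n : ℕ, (2 : ℝ) ^ (j - n : ℤ) ≤ 2 ^ j := fun n =>
    zpow_le_zpow_right₀ one_le_two (by omega)
  have hjn : ∀ n : ℕ, ENNReal.ofReal (2 ^ (j - n : ℤ)) ≤ Metric.ediam E := fun n =>
    (ENNReal.ofReal_le_ofReal (hlevel n)).trans hj
  have hc := hΔ.c_pos
  have hm : 0 < min c 1 := lt_min hc one_pos
  have hC : 0 < C := one_pos.trans_le hE.one_le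
  have hE0 : 0 < Metric.ediam E := (ENNReal.ofReal_pos.2 (by positivity)).trans_le hj
  have hfam : ∀ n, ∀ Q ∈ fam n, Q ∈ Δ (j - n) := by
    rintro n Q ⟨x, hx, rfl, -⟩
    exact (hΔ.cubeAt_mem _ (hQ₀ hx)).1
  have hcount : ∀ n, (fam n).Countable := by
    intro n
    obtain ⟨N, hN⟩ := exists_nat_ge
      (C ^ 2 * ((2 * 2 ^ j / 2 ^ (j - n : ℤ) + 1) / min c 1) ^ 3)
    refine (finite_of_encard_le_coe (hΔ.encard_le hE (hjn n) hx₀ (by positivity) hN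
      (hfam n) ?_)).countable
    rintro Q ⟨x, hx, rfl, -⟩
    refine ⟨x, (hΔ.cubeAt_mem _ (hQ₀ hx)).2, ?_⟩
    rw [div_mul_cancel₀ _ (by positivity)]
    exact hd x hx
  have hι : Countable {p : ℕ × Set Heis // p.2 ∈ fam p.1} := by
    have : {p : ℕ × Set Heis | p.2 ∈ fam p.1} = ⋃ n, (fun Q => (n, Q)) '' fam n := by
      ext ⟨n, Q⟩
      simp
    have hcnt : {p : ℕ × Set Heis | p.2 ∈ fam p.1}.Countable := by
      rw [this]
      exact countable_iUnion fun n => (hcount n).image _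
    exact hcnt.to_subtype
  -- Cubes need not be measurable; the measures of disjoint balls inside them are summed instead.
  choose z hz hzQ hzμ using fun p : {p : ℕ × Set Heis // p.2 ∈ fam p.1} =>
    hΔ.exists_ball hE le_rfl (hjn p.1.1) (hfam _ _ p.2)
  have hanc : ∀ p p' : {p : ℕ × Set Heis // p.2 ∈ fam p.1}, p.1.1 ≤ p'.1.1 →
      ∀ y ∈ p.1.2, y ∈ p'.1.2 → p = p' := by
    rintro ⟨⟨n, Q⟩, hQ⟩ ⟨⟨n', Q'⟩, hQ'⟩ hle y hy hy'
    simp only at hle hy hy' hQ hQ'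
    have hQm := hfam n Q hQ
    have hQm' := hfam n' Q' hQ'
    obtain ⟨x, hx, hxQ, hthin, -⟩ := hQ
    obtain ⟨x', hx', hxQ', -, hmin⟩ := hQ'
    have h1 : x' ∈ Q' := hxQ' ▸ (hΔ.cubeAt_mem _ (hQ₀ hx')).2
    have h2 : x' ∈ Q := hΔ.subset_of_mem (by omega) hQm' hQm hy' hy h1
    have h3 : n = n' := by
      by_contra hne
      refine hmin n (by omega) ?_
      change area u (projW u '' cubeAt Δ (j - n) x') ≤ _
      rw [hΔ.cubeAt_eq hQm h2, ← hxQ]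
      exact hthin
    subst h3
    have h4 : Q = Q' := by rw [← hΔ.cubeAt_eq hQm hy, hΔ.cubeAt_eq hQm' hy']
    subst h4
    rfl
  have hdisj : Pairwise (Function.onFun Disjoint
      fun p : {p : ℕ × Set Heis // p.2 ∈ fam p.1} =>
        Metric.closedBall (z p) (min c 1 * 2 ^ (j - p.1.1 : ℤ)) ∩ E) := by
    intro p p' hne
    refine disjoint_left.2 fun y hy hy' => hne ?_
    rcases le_total p.1.1 p'.1.1 with h | h
    · exact hanc p p' h y (hzQ p hy) (hzQ p' hy')
    · exact (hanc p' p h y (hzQ p' hy') (hzQ p hy)).symm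
  calc _ ≤ area u (projW u '' ⋃ p : {p : ℕ × Set Heis // p.2 ∈ fam p.1}, p.1.2) := by
        refine area_mono u (image_mono ?_)
        rintro x ⟨hx, hex⟩
        have hex' : ∃ n, thin x n := hex
        refine mem_iUnion.2 ⟨⟨(Nat.find hex', cubeAt Δ (j - (Nat.find hex' : ℕ)) x), x, hx, rfl,
          Nat.find_spec hex', fun m hm => Nat.find_min hex' hm⟩, ?_⟩
        exact (hΔ.cubeAt_mem _ (hQ₀ hx)).2
    _ ≤ ∑' p : {p : ℕ × Set Heis // p.2 ∈ fam p.1}, area u (projW u '' p.1.2) :=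
        area_projW_iUnion_le u _
    _ ≤ ∑' p : {p : ℕ × Set Heis // p.2 ∈ fam p.1}, ENNReal.ofReal (κ * C / min c 1 ^ 3) *
          μH[3] (Metric.closedBall (z p) (min c 1 * 2 ^ (j - p.1.1 : ℤ)) ∩ E) := by
        refine ENNReal.tsum_le_tsum ?_
        intro p
        have hp : area u (projW u '' p.1.2) ≤
            ENNReal.ofReal (κ * (2 ^ (j - p.1.1 : ℤ)) ^ 3) := by
          obtain ⟨x, -, hxQ, hthin, -⟩ := p.2
          rw [← hxQ]
          exact hthin
        refine (hp.trans_eq ?_).trans (mul_le_mul_right (hzμ p) _)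
        rw [← ENNReal.ofReal_mul (by positivity)]
        congr 1
        field_simp
    _ = ENNReal.ofReal (κ * C / min c 1 ^ 3) * μH[3]
          (⋃ p, Metric.closedBall (z p) (min c 1 * 2 ^ (j - p.1.1 : ℤ)) ∩ E) := by
        rw [ENNReal.tsum_mul_left, measure_iUnion hdisj fun p => hE.measurableSet_ball _ _]
    _ ≤ ENNReal.ofReal (κ * C / min c 1 ^ 3) * ENNReal.ofReal (C * (3 * 2 ^ j) ^ 3) := by
        refine mul_le_mul_right (le_trans (measure_mono ?_)
          (hE.measure_le hE0 hx₀ (r := 3 * 2 ^ j) (by positivity))) _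
        refine iUnion_subset fun p y hy => ⟨?_, hy.2⟩
        obtain ⟨x, hx, hxQ, -⟩ := p.2
        have h1 : x ∈ p.1.2 := hxQ ▸ (hΔ.cubeAt_mem _ (hQ₀ hx)).2
        have h2 := hΔ.dist_le (hfam _ _ p.2) (hzQ p hy) h1
        rw [Metric.mem_closedBall]
        linarith [dist_triangle y x x₀, hd x hx, hlevel p.1.1]
    _ = _ := by
        rw [← ENNReal.ofReal_mul (by positivity)]
        congr 1
        ring

end Cubes

/-! ### Overlap of the bad cubes -/

open scoped Classical in
/-- The points which lie in more than `M` of the sets `A n`. -/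
def overlap {X : Type*} (A : ℕ → Set X) (M : ℕ) : Set X :=
  {x | ∃ n, M < Nat.count (fun m => x ∈ A m) n}

/-- Chebyshev's inequality for the number of sets of a sequence which contain a point. -/
theorem mul_measure_count_le {X : Type*} [MeasurableSpace X] (μ : Measure X) (A : ℕ → Set X)
    (M : ℕ) : (M : ℝ≥0∞) * μ (overlap A M) ≤ ∑' n, μ (A n) := by
  classical
  -- The sets `A n` need not be measurable; their measurable hulls have the same measure.
  have hmeas : ∀ n, MeasurableSet (toMeasurable μ (A n)) := fun n => measurableSet_toMeasurable _ _
  calc _ ≤ (M : ℝ≥0∞) * μ {x | (M : ℝ≥0∞) ≤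
          ∑' n, (toMeasurable μ (A n)).indicator (fun _ => (1 : ℝ≥0∞)) x} := by
        refine mul_le_mul_right (measure_mono ?_) _
        rintro x ⟨n, hn⟩
        refine le_trans ?_ (ENNReal.sum_le_tsum (Finset.range n))
        rw [Nat.count_eq_card_filter_range] at hn
        calc (M : ℝ≥0∞) ≤ (((Finset.range n).filter fun m => x ∈ A m).card : ℝ≥0∞) := by
              exact_mod_cast hn.le
          _ = ∑ m ∈ Finset.range n, if x ∈ A m then 1 else 0 := by
              rw [Finset.sum_boole]
          _ ≤ _ := by
              refine Finset.sum_le_sum fun m _ => ?_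
              by_cases hx : x ∈ A m
              · simp [hx, subset_toMeasurable μ (A m) hx]
              · simp [hx]
    _ ≤ ∫⁻ x, ∑' n, (toMeasurable μ (A n)).indicator (fun _ => (1 : ℝ≥0∞)) x ∂μ :=
        mul_meas_ge_le_lintegral
          (Measurable.tsum fun n => measurable_const.indicator (hmeas n)) _
    _ = ∑' n, μ (A n) := by
        rw [lintegral_tsum fun n => (measurable_const.indicator (hmeas n)).aemeasurable]
        refine tsum_congr fun n => ?_
        rw [lintegral_indicator (hmeas n), setLIntegral_const, one_mul, measure_toMeasurable]

/-- `β`-numbers of comparable balls are comparable. -/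
theorem lt_beta_of_lt_beta {E : Set Heis} {y z : Heis} {ε r s : ℝ} (hr : 0 < r)
    (hrs : dist z y + r ≤ s) (hsr : s ≤ 8 * r)
    (h : ENNReal.ofReal ε < beta E z r) : ENNReal.ofReal (ε / 8) < beta E y s := by
  have hs : 0 < s := by linarith [dist_nonneg (x := z) (y := y)]
  -- B(z, r) lies in B(y, s), so for a fixed plane only the normalisation s/r ≤ 8 is lost.
  have hplane : ∀ w u, betaPlane E z r w u ≤ 8 * betaPlane E y s w u := by
    intro w u
    refine iSup₂_le fun p hp => ?_
    have hps : p ∈ Metric.closedBall y s ∩ E := by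
      refine ⟨?_, hp.2⟩
      have : dist p z ≤ r := hp.1
      rw [Metric.mem_closedBall]
      linarith [dist_triangle p z y]
    refine le_trans ?_ (mul_le_mul_right (le_iSup₂ (f := fun y' (_ : y' ∈ Metric.closedBall y s ∩ E)
      => Metric.infEDist y' ((fun w' => w * w') '' (vertical u : Set Heis)) / ENNReal.ofReal s)
      p hps) _)
    rw [div_eq_mul_inv, div_eq_mul_inv, mul_left_comm]
    refine mul_le_mul_right ?_ _
    have h8 : (8 : ℝ≥0∞) = ENNReal.ofReal 8 := by norm_num
    rw [← ENNReal.ofReal_inv_of_pos hr, ← ENNReal.ofReal_inv_of_pos hs, h8,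
      ← ENNReal.ofReal_mul (by norm_num)]
    refine ENNReal.ofReal_le_ofReal ?_
    rw [← div_eq_mul_inv, inv_eq_one_div, div_le_div_iff₀ hr hs]
    linarith
  have hb : beta E z r ≤ 8 * beta E y s := by
    unfold beta
    rw [ENNReal.mul_iInf_of_ne (by norm_num) (by norm_num)]
    refine iInf_mono fun u => ?_
    rw [ENNReal.mul_iInf_of_ne (by norm_num) (by norm_num)]
    exact iInf_mono fun w => hplane w u
  by_contra hcon
  refine absurd (h.trans_le (hb.trans (mul_le_mul_right (not_lt.1 hcon) 8))) ?_
  rw [not_lt]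
  have h8 : (8 : ℝ≥0∞) = ENNReal.ofReal 8 := by norm_num
  rw [h8, ← ENNReal.ofReal_mul (by norm_num)]
  exact ENNReal.ofReal_le_ofReal (by linarith)

/-- The points whose cube of level `k` has a neighbour centred at which there is a ball of radius
`2 ^ (k + 1)` with large `β`-number. -/
def badSet (E : Set Heis) (Δ : ℤ → Set (Set Heis)) (ε : ℝ) (k : ℤ) : Set Heis :=
  {y | ∃ y' ∈ cubeAt Δ k y, ∃ z ∈ E, dist z y' ≤ 2 * 2 ^ k ∧ ENNReal.ofReal ε < beta E z (2 * 2 ^ k)}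

/-- The weak geometric lemma gives a packing condition for the bad cubes. -/
theorem WGL.tsum_badSet_le {E : Set Heis} {γ : ℝ → ℝ≥0} (hγ : WGL E γ) {c : ℝ}
    {Δ : ℤ → Set (Set Heis)} (hΔ : IsDavidSystem E c Δ) {ε : ℝ} (hε : 0 < ε) {j : ℤ} {x₀ : Heis}
    (hx₀ : x₀ ∈ E) {Q₀ : Set Heis} (hQ₀ : Q₀ ⊆ E) (hd : ∀ x ∈ Q₀, dist x x₀ ≤ 2 * 2 ^ j) :
    ∑' n : ℕ, μH[3] (Q₀ ∩ badSet E Δ ε (j - n)) ≤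
      2 * (γ (ε / 8) * ENNReal.ofReal ((16 * 2 ^ j) ^ 3)) := by
  -- With k = j - n, a bad y has its witness z within 3 · 2^k, so B(z, 2 · 2^k) lies in B(y, s) for
  -- every s in this interval, and s ≤ 8 · (2 · 2^k). The intervals are disjoint, and bounding 1/s
  -- below on each gives a factor 1/2.
  let I : ℕ → Set ℝ := fun n => Ico (8 * 2 ^ (j - n : ℤ)) (16 * 2 ^ (j - n : ℤ))
  have hpos : ∀ n : ℕ, (0 : ℝ) < 2 ^ (j - n : ℤ) := fun n => by positivity
  have hhalf : ∀ m n : ℕ, m < n → 16 * (2 : ℝ) ^ (j - n : ℤ) ≤ 8 * 2 ^ (j - m : ℤ) := by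
    intro m n hmn
    have h1 : (2 : ℝ) ^ (j - n + 1 : ℤ) ≤ 2 ^ (j - m : ℤ) :=
      zpow_le_zpow_right₀ one_le_two (by omega)
    rw [zpow_add_one₀ two_ne_zero] at h1
    linarith
  have hdisj : Pairwise (Function.onFun Disjoint I) := by
    have aux : ∀ m n : ℕ, m < n → Disjoint (I m) (I n) := fun m n hmn =>
      disjoint_left.2 fun s hs hs' => absurd (hs'.2.trans_le (hhalf m n hmn)) (not_lt.2 hs.1)
    intro m n hmn
    rcases hmn.lt_or_gt with h | h
    · exact aux m n h
    · exact (aux n m h).symm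
  have hsub : ⋃ n, I n ⊆ Ioo 0 (16 * 2 ^ j) := by
    refine iUnion_subset fun n s hs => ⟨by linarith [hs.1, hpos n], hs.2.trans_le ?_⟩
    have : (2 : ℝ) ^ (j - n : ℤ) ≤ 2 ^ j := zpow_le_zpow_right₀ one_le_two (by omega)
    linarith
  let f : ℝ → ℝ≥0∞ := fun s => μH[3] {y | y ∈ E ∩ Metric.closedBall x₀ (16 * 2 ^ j) ∧
    ENNReal.ofReal (ε / 8) < beta E y s} / ENNReal.ofReal s
  have hf : ∀ n : ℕ, ∀ s ∈ I n, μH[3] (Q₀ ∩ badSet E Δ ε (j - n)) /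
      ENNReal.ofReal (16 * 2 ^ (j - n : ℤ)) ≤ f s := by
    intro n s hs
    refine ENNReal.div_le_div (measure_mono ?_) (ENNReal.ofReal_le_ofReal hs.2.le)
    rintro y ⟨hy, y', hy', z, hz, hzy, hβ⟩
    refine ⟨⟨hQ₀ hy, ?_⟩, lt_beta_of_lt_beta (by positivity) ?_ ?_ hβ⟩
    · rw [Metric.mem_closedBall]
      refine (hd y hy).trans ?_
      gcongr
      norm_num
    · obtain ⟨h1, h2⟩ := hΔ.cubeAt_mem (j - n) (hQ₀ hy)
      have := hΔ.dist_le h1 hy' h2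
      linarith [dist_triangle z y' y, hs.1, hpos n]
    · linarith [hs.2]
  have hI : ∀ n : ℕ, μH[3] (Q₀ ∩ badSet E Δ ε (j - n)) / 2 ≤ ∫⁻ s in I n, f s := by
    intro n
    calc _ = ∫⁻ _ in I n, μH[3] (Q₀ ∩ badSet E Δ ε (j - n)) /
            ENNReal.ofReal (16 * 2 ^ (j - n : ℤ)) := by
          rw [setLIntegral_const, Real.volume_Ico, div_eq_mul_inv, div_eq_mul_inv, mul_assoc]
          congr 1
          have h2 : (2 : ℝ≥0∞) = ENNReal.ofReal 2 := by norm_num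
          rw [h2, ← ENNReal.ofReal_inv_of_pos two_pos,
            ← ENNReal.ofReal_inv_of_pos (by positivity), ← ENNReal.ofReal_mul (by positivity)]
          congr 1
          have := (hpos n).ne'
          field_simp
          norm_num
      _ ≤ _ := setLIntegral_mono' measurableSet_Ico fun s hs => hf n s hs
  have hsum : (∑' n : ℕ, μH[3] (Q₀ ∩ badSet E Δ ε (j - n))) / 2 ≤
      γ (ε / 8) * ENNReal.ofReal ((16 * 2 ^ j) ^ 3) := by
    rw [div_eq_mul_inv, ← ENNReal.tsum_mul_right]
    calc _ ≤ ∑' n, ∫⁻ s in I n, f s := ENNReal.tsum_le_tsum hI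
      _ = ∫⁻ s in ⋃ n, I n, f s := (lintegral_iUnion (fun n => measurableSet_Ico) hdisj f).symm
      _ ≤ ∫⁻ s in Ioo 0 (16 * 2 ^ j), f s := lintegral_mono_set hsub
      _ ≤ _ := hγ (ε / 8) (by positivity) x₀ hx₀ (16 * 2 ^ j) (by positivity)
  rwa [ENNReal.div_le_iff_le_mul (by simp) (by simp), mul_comm] at hsum

end Heis

/-! ### Decomposition into intrinsic Lipschitz graphs -/

namespace Heis

variable {E : Set Heis} {C c : ℝ} {Δ : ℤ → Set (Set Heis)}

/-- There is a level, not above that of `Q₀`, which is comparable to the diameter of `Q₀` from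
above and at most the diameter of `E`. -/
theorem IsDavidSystem.exists_level (hΔ : IsDavidSystem E c Δ) (hE0 : 0 < Metric.ediam E) {j : ℤ}
    {Q₀ : Set Heis} (hQ₀ : Q₀ ∈ Δ j) : ∃ k ≤ j, ENNReal.ofReal (2 ^ k) ≤ Metric.ediam E ∧
      ∀ x ∈ Q₀, ∀ y ∈ Q₀, dist x y ≤ 2 * (2 : ℝ) ^ k := by
  by_cases h : ENNReal.ofReal (2 ^ j) ≤ Metric.ediam E
  · refine ⟨j, le_rfl, h, fun x hx y hy => (hΔ.dist_le hQ₀ hx hy).trans ?_⟩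
    have : (0 : ℝ) < 2 ^ j := by positivity
    linarith
  have hlt := not_le.1 h
  have hfin : Metric.ediam E ≠ ⊤ := hlt.ne_top
  have hD : 0 < (Metric.ediam E).toReal := ENNReal.toReal_pos hE0.ne' hfin
  obtain ⟨k, hk1, hk2⟩ := exists_mem_Ico_zpow hD one_lt_two
  refine ⟨k, ?_, ?_, fun x hx y hy => ?_⟩
  · have h1 : (Metric.ediam E).toReal ≤ 2 ^ j :=
      ENNReal.toReal_le_of_le_ofReal (by positivity) hlt.le
    exact (zpow_le_zpow_iff_right₀ (one_lt_two (α := ℝ))).1 (hk1.trans h1)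
  · rw [← ENNReal.ofReal_toReal hfin]
    exact ENNReal.ofReal_le_ofReal hk1
  · rw [zpow_add_one₀ two_ne_zero, mul_comm] at hk2
    refine le_trans ?_ hk2.le
    rw [dist_edist]
    exact ENNReal.toReal_mono hfin
      (Metric.edist_le_ediam_of_mem (hΔ.subset hQ₀ hx) (hΔ.subset hQ₀ hy))

/-- The points of `Q₀` which lie in few bad cubes, and in no cube with small vertical projection,
split into boundedly many intrinsic Lipschitz graphs. -/
theorem IsDavidSystem.exists_graphs (hΔ : IsDavidSystem E c Δ) (hE : IsRegular3 E C) (u : Circle)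
    {j : ℤ} (hj : ENNReal.ofReal (2 ^ j) ≤ Metric.ediam E) {Q₀ : Set Heis} (hQ₀ : Q₀ ⊆ E)
    (hd : ∀ x ∈ Q₀, ∀ y ∈ Q₀, dist x y ≤ 2 * (2 : ℝ) ^ j) {δ : ℝ} (hδ : 0 < δ) (hδ' : δ ≤ 1 / 2)
    (M : ℕ) {N : ℕ} (hN : C ^ 2 * ((3 + 1) / min c 1) ^ 3 ≤ N) :
    ∃ F : (Fin M → Fin (N + 1)) → Set Heis,
      (∀ i, F i ⊆ Q₀ ∧ IsIntrinsicLipGraph u (1 / (δ / 2)) (F i)) ∧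
      Q₀ \ ⋃ i, F i ⊆
        {x ∈ Q₀ | ∃ n : ℕ, area u (projW u '' cubeAt Δ (j - n) x) ≤
          ENNReal.ofReal (30 * δ * (2 ^ (j - n : ℤ)) ^ 3)} ∪
        overlap (fun n : ℕ => Q₀ ∩ badSet E Δ (δ / 64) (j - n)) M := by
  set thin : Set Heis := {x ∈ Q₀ | ∃ n : ℕ, area u (projW u '' cubeAt Δ (j - n) x) ≤
          ENNReal.ofReal (30 * δ * (2 ^ (j - n : ℤ)) ^ 3)}
  set many : Set Heis := overlap (fun n : ℕ => Q₀ ∩ badSet E Δ (δ / 64) (j - n)) M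
  let G : Set Heis := Q₀ \ (thin ∪ many)
  have hGE : ∀ x : G, (x : Heis) ∈ E := fun x => hQ₀ x.2.1
  have hjn : ∀ n : ℕ, ENNReal.ofReal (2 ^ (j - n : ℤ)) ≤ Metric.ediam E := fun n =>
    (ENNReal.ofReal_le_ofReal (zpow_le_zpow_right₀ one_le_two (by omega))).trans hj
  obtain ⟨col, hcol⟩ := exists_coding (X := G) (fun n x => cubeAt Δ (j - n) x)
    (fun x n => (x : Heis) ∈ Q₀ ∩ badSet E Δ (δ / 64) (j - n))
    (fun n x y => dist (x : Heis) y ≤ 2 * 2 ^ (j - n : ℤ)) M N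
    (fun m n hmn x y h => hΔ.cubeAt_congr_of_le (by omega) (hGE x) (hGE y) h)
    (fun n x y h => by
      have h' : cubeAt Δ (j - n) (x : Heis) = cubeAt Δ (j - n) (y : Heis) := h
      simp only [badSet, mem_inter_iff, mem_ofPred_eq, h', x.2.1, y.2.1])
    (fun n x y h => by rwa [dist_comm])
    (fun n x => by
      refine hΔ.encard_le hE (hjn n) (hGE x) (ρ := 3) (by norm_num) hN ?_ ?_
      · rintro Q ⟨x', y, -, -, rfl⟩
        exact (hΔ.cubeAt_mem _ (hGE y)).1
      · rintro Q ⟨x', y, h1, h2, rfl⟩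
        refine ⟨y, (hΔ.cubeAt_mem _ (hGE y)).2, ?_⟩
        have h3 := hΔ.cubeAt_mem (j - n) (hGE x)
        have h4 : (x' : Heis) ∈ cubeAt Δ (j - n) (x : Heis) := by
          have := (hΔ.cubeAt_mem (j - n) (hGE x')).2
          rwa [show cubeAt Δ (j - n) (x' : Heis) = cubeAt Δ (j - n) (x : Heis) from h1] at this
        have h5 := hΔ.dist_le h3.1 h4 h3.2
        linarith [dist_triangle_left (y : Heis) x x'])
    (fun x n => by
      by_contra hcon
      exact x.2.2 (Or.inr ⟨n, not_le.1 hcon⟩))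
  refine ⟨fun i => {x | ∃ h : x ∈ G, col ⟨x, h⟩ = i}, fun i => ⟨?_, ?_⟩, ?_⟩
  · rintro x ⟨hx, -⟩
    exact hx.1
  · refine IsIntrinsicLipGraph.of_forall_notMem ?_
    rintro x ⟨hx, hxi⟩ y ⟨hy, hyi⟩ hxy
    -- The scale with 2^k < d(x, y) ≤ 2^(k+1): the strict bound puts x and y in different cubes of
    -- level k.
    obtain ⟨k, hk1, hk2⟩ := exists_mem_Ioc_zpow (dist_pos.2 hxy) one_lt_two
    rw [zpow_add_one₀ two_ne_zero, mul_comm] at hk2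
    have hkj : k ≤ j := by
      have h1 := hk1.trans_le (hd x hx.1 y hy.1)
      rw [mul_comm, ← zpow_add_one₀ two_ne_zero] at h1
      have := (zpow_lt_zpow_iff_right₀ (one_lt_two (α := ℝ))).1 h1
      omega
    obtain ⟨n, rfl⟩ : ∃ n : ℕ, k = j - n := ⟨(j - k).toNat, by omega⟩
    have hxE := hQ₀ hx.1
    have hyE := hQ₀ hy.1
    obtain ⟨hx1, hx2⟩ := hΔ.cubeAt_mem (j - n) hxE
    obtain ⟨hy1, hy2⟩ := hΔ.cubeAt_mem (j - n) hyE
    have hne : cubeAt Δ (j - n) x ≠ cubeAt Δ (j - n) y := by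
      intro h
      rw [← h] at hy2
      exact absurd (hΔ.dist_le hx1 hx2 hy2) (not_le.2 hk1)
    -- Otherwise x witnesses that both cubes are bad, and the words differ.
    have hβ : beta E x (2 * 2 ^ (j - n : ℤ)) ≤ ENNReal.ofReal (δ / 64) := by
      by_contra hcon
      have hcon := not_le.1 hcon
      refine hcol n ⟨x, hx⟩ ⟨y, hy⟩ hk2 hne ⟨hx.1, x, hx2, x, hxE, ?_, hcon⟩
        ⟨hy.1, y, hy2, x, hxE, hk2, hcon⟩ (hxi.trans hyi.symm)
      rw [dist_self]
      positivity
    rw [dist_comm] at hk1 hk2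
    rcases area_le_or_notMem_cone hxE u hδ hδ' (by positivity) hβ with h | h
    · exfalso
      -- The cube of x lies in B(x, 2^k), so the first alternative would make it thin.
      refine hx.2 (Or.inl ⟨hx.1, n, le_trans (area_mono u (image_mono ?_)) h⟩)
      exact fun w hw => ⟨hΔ.dist_le hx1 hw hx2, hΔ.subset hx1 hw⟩
    · exact h y hyE hk1 hk2
  · rintro x ⟨hx, hxF⟩
    by_contra hcon
    exact hxF (mem_iUnion.2 ⟨col ⟨x, hx, hcon⟩, ⟨hx, hcon⟩, rfl⟩)

end Heis

end

/-! ### Choice of the constants -/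

theorem theorem3p8 (C : ℝ) (γ : ℝ → ℝ≥0) (c b : ℝ) (hb : 0 < b) :
    ∃ (α : ℝ) (M : ℕ), 0 < α ∧
      ∀ E : Set Heis, Heis.IsRegular3 E C → Heis.WGL E γ →
      ∀ Δ : ℤ → Set (Set Heis), Heis.IsDavidSystem E c Δ →
      ∀ j : ℤ, ∀ Q₀ ∈ Δ j, ∀ u : Circle,
        ∃ F : Fin M → Set Heis,
          (∀ i, F i ⊆ Q₀ ∧ Heis.IsIntrinsicLipGraph u (1 / α) (F i)) ∧
          Heis.area u (Heis.projW u '' (Q₀ \ ⋃ i, F i)) ≤ ENNReal.ofReal b * μH[3] Q₀ := by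
  by_cases hCc : 1 ≤ C ∧ 0 < c
  swap
  · exact ⟨1, 0, one_pos, fun E hE _ Δ hΔ => absurd ⟨hE.one_le, hΔ.c_pos⟩ hCc⟩
  obtain ⟨hC1, hc⟩ := hCc
  have hC : 0 < C := one_pos.trans_le hC1
  have hl : 0 < min c 1 := lt_min hc one_pos
  set l := min c 1 with hl_def
  -- Half of b is reserved for thin cubes, the other half for points in many bad cubes.
  obtain ⟨δ, hδ, hδ', hδb⟩ : ∃ δ : ℝ, 0 < δ ∧ δ ≤ 1 / 2 ∧
      27 * (30 * δ) * C ^ 2 / l ^ 3 ≤ b / 2 * (C⁻¹ * l ^ 3) := by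
    refine ⟨min (1 / 2) (b * l ^ 6 / (1620 * C ^ 3)), lt_min (by norm_num) (by positivity),
      min_le_left _ _, ?_⟩
    calc _ ≤ 27 * (30 * (b * l ^ 6 / (1620 * C ^ 3))) * C ^ 2 / l ^ 3 := by
          gcongr
          exact min_le_right _ _
      _ = _ := by field_simp; norm_num
  -- Here 12 = 6 · 2, from the projection bound and the packing bound; 16 comes from the radius 16 ·
  -- 2^j used in the WGL.
  obtain ⟨M, hM⟩ := exists_nat_gt (12 * (γ (δ / 64 / 8) : ℝ) * 16 ^ 3 / (b / 2 * (C⁻¹ * l ^ 3)))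
  have hM0 : (0 : ℝ) < M := lt_of_le_of_lt (by positivity) hM
  obtain ⟨N, hN⟩ := exists_nat_ge (C ^ 2 * ((3 + 1) / l) ^ 3)
  let e := Fintype.equivFin (Fin M → Fin (N + 1))
  refine ⟨δ / 2, Fintype.card (Fin M → Fin (N + 1)), by positivity, ?_⟩
  intro E hE hγ Δ hΔ j₀ Q₀ hQ₀ u
  have hQE := hΔ.subset hQ₀
  -- A one-point set E admits no scale 2^k ≤ diam E, but its projection is null.
  by_cases hE0 : Metric.ediam E = 0
  · refine ⟨fun _ => ∅, fun i => ⟨empty_subset _, fun x hx => absurd hx (notMem_empty x)⟩, ?_⟩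
    refine (Heis.area_projW_le_ediam u).trans ?_
    have h0 : Metric.ediam (Q₀ \ ⋃ _ : Fin (Fintype.card (Fin M → Fin (N + 1))), ∅) = 0 :=
      nonpos_iff_eq_zero.1 ((Metric.ediam_mono (sdiff_subset.trans hQE)).trans hE0.le)
    rw [h0]
    simp
  have hE0 : 0 < Metric.ediam E := pos_iff_ne_zero.2 hE0
  -- The level of Q₀ may be far above the scale of diam E; everything is run from the level j
  -- instead.
  obtain ⟨j, hjj, hj, hd⟩ := hΔ.exists_level hE0 hQ₀
  obtain ⟨x₀, hx₀⟩ := hΔ.nonempty j₀ Q₀ hQ₀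
  have hd₀ : ∀ x ∈ Q₀, dist x x₀ ≤ 2 * (2 : ℝ) ^ j := fun x hx => hd x hx x₀ hx₀
  obtain ⟨F, hF, hcover⟩ := hΔ.exists_graphs hE u hj hQE hd hδ hδ' M hN
  refine ⟨fun i => F (e.symm i), fun i => hF _, ?_⟩
  rw [e.symm.surjective.iUnion_comp F]
  have hthin := hΔ.area_thin_le hE u hj (hQE hx₀) hQE hd₀ (κ := 30 * δ) (by positivity)
  have hcheb := Heis.mul_measure_count_le (μH[3])
    (fun n : ℕ => Q₀ ∩ Heis.badSet E Δ (δ / 64) (j - n)) M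
  have hpack := hγ.tsum_badSet_le hΔ (ε := δ / 64) (by positivity) (hQE hx₀) hQE hd₀
  have hlow : ENNReal.ofReal (C⁻¹ * (l * 2 ^ j) ^ 3) ≤ μH[3] Q₀ := by
    obtain ⟨z, -, hzQ, hz⟩ := hΔ.exists_ball hE hjj hj hQ₀
    exact hz.trans (measure_mono hzQ)
  set many : Set Heis := Heis.overlap (fun n : ℕ => Q₀ ∩ Heis.badSet E Δ (δ / 64) (j - n)) M
  have hmany : μH[3] many ≤
      ENNReal.ofReal (2 * ((γ (δ / 64 / 8) : ℝ) * (16 * 2 ^ j) ^ 3) / M) := by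
    rw [ENNReal.ofReal_div_of_pos hM0, ENNReal.ofReal_natCast,
      ENNReal.le_div_iff_mul_le (by simp [Nat.cast_pos.1 hM0 |>.ne']) (by simp), mul_comm]
    refine (hcheb.trans hpack).trans_eq ?_
    rw [ENNReal.ofReal_mul two_pos.le, ENNReal.ofReal_mul (by positivity), ENNReal.ofReal_coe_nnreal]
    norm_num
  calc _ ≤ _ := Heis.area_mono u (image_mono hcover)
    _ ≤ _ := by rw [image_union]; exact Heis.area_union_le u _ _
    _ ≤ ENNReal.ofReal (27 * (30 * δ) * C ^ 2 / l ^ 3 * (2 ^ j) ^ 3) +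
          6 * ENNReal.ofReal (2 * ((γ (δ / 64 / 8) : ℝ) * (16 * 2 ^ j) ^ 3) / M) :=
        add_le_add hthin ((Heis.area_projW_le_hausdorff u _).trans (mul_le_mul_right hmany 6))
    _ ≤ ENNReal.ofReal b * ENNReal.ofReal (C⁻¹ * (l * 2 ^ j) ^ 3) := by
        have h6 : (6 : ℝ≥0∞) = ENNReal.ofReal 6 := by norm_num
        rw [h6, ← ENNReal.ofReal_mul (by norm_num), ← ENNReal.ofReal_mul hb.le,
          ← ENNReal.ofReal_add (by positivity) (by positivity)]
        refine ENNReal.ofReal_le_ofReal ?_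
        have h1 : 12 * (γ (δ / 64 / 8) : ℝ) * 16 ^ 3 / M ≤ b / 2 * (C⁻¹ * l ^ 3) := by
          rw [div_lt_iff₀ (by positivity)] at hM
          rw [div_le_iff₀ hM0]
          linarith
        calc _ = (27 * (30 * δ) * C ^ 2 / l ^ 3 + 12 * (γ (δ / 64 / 8) : ℝ) * 16 ^ 3 / M) *
              (2 ^ j) ^ 3 := by ring
          _ ≤ (b / 2 * (C⁻¹ * l ^ 3) + b / 2 * (C⁻¹ * l ^ 3)) * (2 ^ j) ^ 3 := by gcongr
          _ = _ := by ring
    _ ≤ _ := mul_le_mul_right hlow _
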